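/- **Setting.** Let $N$ be a number of blocks, $n_1,\dots,n_N$ dimensions, and consider the minimization over $x=(x_1,\dots,x_N)\in\mathbb R^{n_1}\times\dots\times\mathbb R^{n_N}$ (with the Euclidean norm) of $$\Phi(x)=F(x)+G(x),\qquad F(x)=\tfrac1N\sum_{i=1}^N f_i(x_i),$$ where each $f_i:\mathbb R^{n_i}\to\mathbb R$ is differentiable with $L_i$-Lipschitz continuous gradient ($L_i\ge 0$), $G$ is a proper, lower semicontinuous and convex function with values in $(-\infty,\infty]$, and $\operatorname{argmin}\Phi\neq\emptyset$. The $f_i$ need not be convex. **Algorithm.** Let $\gamma_i\in(0,N/L_i)$ ($\gamma_i\in(0,\infty)$ if $L_i=0$), and $\Gamma=\operatorname{blockdiag}(\gamma_1 I_{n_1},\dots,\gamma_N I_{n_N})$. From an arbitrary $x^0$, for $k=0,1,2,\dots$ let $$z^k\in\operatorname{prox}_G^{\Gamma^{-1}}\bigl(x^k-\Gamma\nabla F(x^k)\bigr),\qquad \operatorname{prox}_G^{\Gamma^{-1}}(u)=\operatorname*{argmin}_{w}\bigl\{G(w)+\tfrac12\langle w-u,\Gamma^{-1}(w-u)\rangle\bigr\},$$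 select a set of indices $I^{k+1}\subseteq\{1,\dots,N\}$, and set $x_i^{k+1}=z_i^k$ for $i\in I^{k+1}$ and $x_i^{k+1}=x_i^k$ for $i\notin I^{k+1}$. The sampling is *essentially cyclic*: there is $T\ge1$ such that every index $i$ belongs to at least one of $I^{k+1},\dots,I^{k+T}$, for every $k\ge 0$. **Subdifferentials and the KL property.** For $h$ with values in $(-\infty,\infty]$ and $h(x)<\infty$, the regular subdifferential $\hat\partial h(x)$ is the set of $v$ with $h(y)\ge h(x)+\langle v,y-x\rangle+o(\|y-x\|)$ as $y\to x$, and the limiting subdifferential $\partial h(x)$ is the set of limits of sequences $v^j\in\hat\partial h(u^j)$ with $u^j\to x$ and $h(u^j)\to h(x)$; both are empty where $h=\infty$. A point $x$ is *stationary* for $h$ if $0\in\hat\partial h(x)$. The function $h$ has the *KL property with exponent* $\theta\in(0,1)$ if for every $\bar w$ with $\partial h(\bar w)\ne\emptyset$ there exist $\varepsilon,\eta,\varrho>0$ such that, with $\psi(s)=\varrho s^{1-\theta}$, $$\psi'\bigl(h(w)-h(\bar w)\bigr)\,\operatorname{dist}\bigl(0,\partial h(w)\bigr)\ge1$$ for all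 $w$ with $\|w-\bar w\|<\varepsilon$ and $h(\bar w)<h(w)<h(\bar w)+\eta$ (where $\operatorname{dist}(0,\emptyset)=\infty$). **Theorem.** In this setting, suppose in addition that $\Phi$ is coercive, i.e. $\Phi(x)\to\infty$ as $\|x\|\to\infty$, and has the KL property with exponent $\theta\in(0,1)$. Then any sequences $(x^k)$ and $(z^k)$ generated by the algorithm with essentially cyclic sampling both converge to one and the same point $x^\star$, which is stationary for $\Phi$. Moreover, if $\theta\le\tfrac12$, then $\|z^k-x^k\|\to0$, $x^k\to x^\star$ and $z^k\to x^\star$ at R-linear rate, where $s^k\to s$ at R-linear rate means that there are $C\in\mathbb R$ and $r\in(0,1)$ with $\|s^k-s\|\le C\,r^k$ for all $k$. -/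

import Mathlib

open Filter Topology
open scoped NNReal ENNReal

noncomputable section

namespace BCPG

/-! ### Extended-real-valued functions `h : V → (-∞, ∞]` on a Euclidean space -/

section General

variable {V : Type*} [NormedAddCommGroup V] [InnerProductSpace ℝ V]

/-- `h` is proper: it never takes the value `-∞` and it is finite somewhere. -/
def IsProper (h : V → EReal) : Prop :=
  (∀ x, h x ≠ ⊥) ∧ ∃ x, h x ≠ ⊤

/-- `h` is convex: its epigraph is a convex set. -/
def IsConvex (h : V → EReal) : Prop :=
  Convex ℝ {p : V × ℝ | h p.1 ≤ (p.2 : EReal)}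

/-- `h` is coercive: `h x → ∞` as `‖x‖ → ∞`. -/
def IsCoercive (h : V → EReal) : Prop :=
  Tendsto h (Bornology.cobounded V) (𝓝 ⊤)

/-- The set of global minimizers of `h`. -/
def argminSet (h : V → EReal) : Set V :=
  {x | ∀ y, h x ≤ h y}

/-- The effective domain of `h`, the set of points where `h` is finite
(the clause `h x ≠ ⊥` is automatic for proper functions). -/
def effDom (h : V → EReal) : Set V :=
  {x | h x ≠ ⊥ ∧ h x ≠ ⊤}

/-- The regular (Fréchet) subdifferential of `h` at `x`: the vectors `v` such that `h` is finite
at `x` and `h y ≥ h x + ⟪v, y - x⟫ + o(‖y - x‖)` as `y → x`. -/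
def regSubdiff (h : V → EReal) (x : V) : Set V :=
  {v | x ∈ effDom h ∧ ∀ ε : ℝ, 0 < ε →
    ∀ᶠ y in 𝓝 x, h x + ((inner ℝ v (y - x) - ε * ‖y - x‖ : ℝ) : EReal) ≤ h y}

/-- The (limiting, Mordukhovich) subdifferential of `h` at `x`: the limits of regular subgradients
`v j` at points `u j → x` with `h (u j) → h x`, where `h` is finite at `x`. -/
def limSubdiff (h : V → EReal) (x : V) : Set V :=
  {v | x ∈ effDom h ∧ ∃ (u w : ℕ → V), Tendsto u atTop (𝓝 x) ∧
    Tendsto (fun j => h (u j)) atTop (𝓝 (h x)) ∧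
    (∀ j, w j ∈ regSubdiff h (u j)) ∧ Tendsto w atTop (𝓝 v)}

/-- The point `x` is stationary for `h`: `0` is a regular subgradient of `h` at `x`. -/
def IsStationary (h : V → EReal) (x : V) : Prop :=
  (0 : V) ∈ regSubdiff h x

/-- The Kurdyka-Łojasiewicz inequality with exponent `θ` at the point `a`, with desingularizing
function `ψ s = ρ * s ^ (1 - θ)`. The distance of `0` from the subdifferential is extended-valued,
so it is `∞` where the subdifferential is empty. -/
def HasKLAt (h : V → EReal) (θ : ℝ) (a : V) : Prop :=
  ∃ ε > (0 : ℝ), ∃ η > (0 : ℝ), ∃ ρ > (0 : ℝ), ∀ w : V, ‖w - a‖ < ε →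
    h a < h w → h w < h a + (η : EReal) →
      1 ≤ ENNReal.ofReal (deriv (fun s : ℝ => ρ * s ^ (1 - θ)) (h w - h a).toReal) *
        Metric.infEDist (0 : V) (limSubdiff h w)

/-- The Kurdyka-Łojasiewicz property with exponent `θ`: the inequality holds at every point where
the subdifferential is nonempty. -/
def HasKL (h : V → EReal) (θ : ℝ) : Prop :=
  ∀ a : V, (limSubdiff h a).Nonempty → HasKLAt h θ a

/-- The proximal mapping of `h` at `u` in the metric `‖x‖_A ^ 2 = ⟪x, A x⟫`: the set of minimizers
of `w ↦ h w + ‖w - u‖_A ^ 2 / 2`. -/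
def prox (A : V →ₗ[ℝ] V) (h : V → EReal) (u : V) : Set V :=
  argminSet fun w => h w + ((1 / 2 * inner ℝ (w - u) (A (w - u)) : ℝ) : EReal)

end General

/-- The sequence `s` converges to `l` at R-linear rate. -/
def ConvergesRLinearly {X : Type*} [PseudoMetricSpace X] (s : ℕ → X) (l : X) : Prop :=
  ∃ C r : ℝ, 0 < r ∧ r < 1 ∧ ∀ k, dist (s k) l ≤ C * r ^ k

/-! ### The block-structured problem and the algorithm -/

/-- The product `ℝ^{n₁} × ⋯ × ℝ^{n_N}`, with its Euclidean structure. -/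
abbrev BlockSpace {N : ℕ} (n : Fin N → ℕ) : Type :=
  PiLp 2 fun i => EuclideanSpace ℝ (Fin (n i))

section Blocks

variable {N : ℕ} {n : Fin N → ℕ}

/-- The linear map `blockdiag(c₁ I, …, c_N I)`. -/
def blockDiag (n : Fin N → ℕ) (c : Fin N → ℝ) : BlockSpace n →ₗ[ℝ] BlockSpace n where
  toFun x := WithLp.toLp 2 fun i => c i • x i
  map_add' x y := by ext i j; simp
  map_smul' a x := by ext i j; simp [mul_left_comm]

/-- The smooth term `F(x) = (1/N) ∑ i, f i (x i)`. -/
def smoothTerm (f : ∀ i, EuclideanSpace ℝ (Fin (n i)) → ℝ) (x : BlockSpace n) : ℝ :=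
  1 / (N : ℝ) * ∑ i, f i (x i)

/-- The cost `Φ = F + G`. -/
def cost (f : ∀ i, EuclideanSpace ℝ (Fin (n i)) → ℝ) (G : BlockSpace n → EReal)
    (x : BlockSpace n) : EReal :=
  (smoothTerm f x : EReal) + G x

/-- The setting: each `f i` is differentiable with `L i`-Lipschitz gradient, `G` is proper and
lower semicontinuous, and `Φ = F + G` attains its minimum. -/
structure ProblemSetting (f : ∀ i, EuclideanSpace ℝ (Fin (n i)) → ℝ) (L : Fin N → ℝ≥0)
    (G : BlockSpace n → EReal) : Prop where
  differentiable : ∀ i, Differentiable ℝ (f i)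
  lipschitz_gradient : ∀ i, LipschitzWith (L i) (gradient (f i))
  proper : IsProper G
  lsc : LowerSemicontinuous G
  exists_min : (argminSet (cost f G)).Nonempty

/-- The sequences `x`, `z` are generated by the forward-backward block-coordinate scheme with
stepsizes `γ i`, where `I (k + 1)` is the set of blocks updated at iteration `k`. -/
structure IsBCSequence (f : ∀ i, EuclideanSpace ℝ (Fin (n i)) → ℝ) (G : BlockSpace n → EReal)
    (γ : Fin N → ℝ) (I : ℕ → Set (Fin N)) (x z : ℕ → BlockSpace n) : Prop where
  forward_backward : ∀ k, z k ∈ prox (blockDiag n fun i => (γ i)⁻¹) G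
    (x k - blockDiag n γ (gradient (smoothTerm f) (x k)))
  update : ∀ k, ∀ i ∈ I (k + 1), x (k + 1) i = z k i
  keep : ∀ k, ∀ i ∉ I (k + 1), x (k + 1) i = x k i

/-- Essentially cyclic sampling: for some `T ≥ 1`, each index is selected at least once within any
`T` consecutive iterations. -/
def EssentiallyCyclic (I : ℕ → Set (Fin N)) : Prop :=
  ∃ T : ℕ, 1 ≤ T ∧ ∀ (k : ℕ) (i : Fin N), ∃ t, 1 ≤ t ∧ t ≤ T ∧ i ∈ I (k + t)

end Blocks

end BCPG

end

/-!
The proof follows the values of a model of `Φ = F + G` along the iteration. Let `D` be the Bregman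
distance of `½ ‖·‖² - F`, with the norm of the metric of the inverse stepsizes (`blockGap`). The
stepsize bound makes it comparable to the squared distance, although `F` need not be convex, and it
is a sum over the blocks. Completing the square, `z k` minimizes `w ↦ Φ w + D w (x k)`
(`cost_add_blockGap_le`); let `φ k` be the minimum. Replacing blocks of `x k` by those of `z k`
removes the corresponding terms of `D (z k) (x k)`, so that
`φ (k + 1) ≤ Φ (z k) + D (z k) (x (k + 1)) ≤ φ k - c ‖x (k + 1) - x k‖ ^ 2`
(`blockGap_update_le`). Convexity of `G` makes `z k` a Lipschitz function of `x k`
(`norm_sub_le_of_forward_backward`); as every block is updated within `T` steps, the residual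
`‖z k - x k‖` is therefore at most a multiple of the length of `T` consecutive steps
(`residual_le_window`).

These facts form the structure `IsModelDescent`, for which convergence is proved in
`IsModelDescent.convergence`. Cluster points are stationary with value `φ∞ = lim φ k`
(`IsModelDescent.cluster_point`). Minimality and the three-point identity of `D` give a subgradient
of `Φ` at `z k` of size `O(‖z k - x k‖)`, so the KL inequality, together with
`φ k ≤ Φ (z k) + C ‖z k - x k‖ ^ 2`, bounds `(φ k - φ∞) ^ τ` by a multiple of the length of `T`
steps, where `τ = max θ (1/2)`. Concavity of `s ↦ s ^ (1 - τ)` then bounds the length of the tail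
after `k` by a multiple of `(φ k - φ∞) ^ (1 - τ)` (`exists_sum_le_rpow_of_lojasiewicz`), which
gives convergence. If `θ ≤ 1/2`, then `τ = 1/2`, and the same inequalities show that `φ k - φ∞`
contracts by a fixed factor every `T` steps (`exists_sqrt_le_geometric_of_lojasiewicz`).
-/

/-! ### Real sequences with sufficient decrease -/

lemma window_sq_le {e d : ℕ → ℝ} {c : ℝ} (hc : 0 < c)
    (hdec : ∀ k, e (k + 1) + c * d k ^ 2 ≤ e k) (T k : ℕ) :
    c * (∑ t ∈ Finset.range T, d (k + t)) ^ 2 ≤ T * (e k - e (k + T)) := by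
  have h1 : c * ∑ t ∈ Finset.range T, d (k + t) ^ 2 ≤ e k - e (k + T) := by
    induction T with
    | zero => simp
    | succ m ih =>
      rw [Finset.sum_range_succ, mul_add]
      have := hdec (k + m)
      rw [← add_assoc]
      linarith
  have h2 := sq_sum_le_card_mul_sum_sq (s := Finset.range T) (f := fun t => d (k + t))
  rw [Finset.card_range] at h2
  calc _ ≤ c * (T * ∑ t ∈ Finset.range T, d (k + t) ^ 2) := by gcongr
    _ = T * (c * ∑ t ∈ Finset.range T, d (k + t) ^ 2) := by ring
    _ ≤ _ := by gcongr

lemma antitone_of_sufficient_decrease {e d : ℕ → ℝ} {c : ℝ} (hc : 0 < c)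
    (hdec : ∀ k, e (k + 1) + c * d k ^ 2 ≤ e k) : Antitone e :=
  antitone_nat_of_succ_le fun k => by nlinarith [hdec k, sq_nonneg (d k)]

/-- Tangent inequality for the concave function `s ↦ s ^ (1 - τ)`, multiplied by `a ^ τ`. -/
lemma mul_sub_le_rpow_mul_sub {a b τ : ℝ} (ha : 0 ≤ a) (hb : 0 ≤ b) (h0 : 0 < τ) (h1 : τ < 1) :
    (1 - τ) * (a - b) ≤ a ^ τ * (a ^ (1 - τ) - b ^ (1 - τ)) := by
  have h := Real.geom_mean_le_arith_mean2_weighted h0.le (sub_nonneg.2 h1.le) ha hb (by ring)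
  have h2 : a ^ τ * a ^ (1 - τ) = a := by
    rw [← Real.rpow_add_of_nonneg ha h0.le (by linarith)]; simp
  rw [mul_sub (a ^ τ), h2]
  linarith

/-- Sufficient decrease and the Łojasiewicz bound `e k ^ τ ≤ B W` over windows of length `T` bound
the tails of `∑ d` by a multiple of `e k ^ (1 - τ)`. On one window, decrease gives
`e k - e (k + T) ≥ (c / T) W ^ 2`, and concavity of `s ↦ s ^ (1 - τ)` bounds the left side by a
multiple of `W * (e k ^ (1 - τ) - e (k + T) ^ (1 - τ))`; the resulting bounds on `W` telescope. -/
theorem exists_sum_le_rpow_of_lojasiewicz {e d : ℕ → ℝ} {c B τ : ℝ} {T K : ℕ} (hT : 1 ≤ T)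
    (hc : 0 < c) (hB : 0 < B) (he : ∀ k, 0 ≤ e k) (hd : ∀ k, 0 ≤ d k) (h0 : 0 < τ) (h1 : τ < 1)
    (hdec : ∀ k, e (k + 1) + c * d k ^ 2 ≤ e k)
    (hL : ∀ k ≥ K, e k ^ τ ≤ B * ∑ t ∈ Finset.range T, d (k + t)) :
    ∃ C : ℝ, 0 ≤ C ∧ ∀ k ≥ K, ∀ m, ∑ t ∈ Finset.range m, d (k + t) ≤ C * e k ^ (1 - τ) := by
  have hT0 : (0 : ℝ) < T := by exact_mod_cast hT
  have h1' : 0 < 1 - τ := sub_pos.2 h1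
  set C := T * B / (c * (1 - τ)) with hC
  have hC0 : 0 < C := by positivity
  have hanti := antitone_of_sufficient_decrease hc hdec
  have hwin : ∀ k ≥ K, ∑ t ∈ Finset.range T, d (k + t) ≤
      C * (e k ^ (1 - τ) - e (k + T) ^ (1 - τ)) := by
    intro k hk
    have hW : 0 ≤ ∑ t ∈ Finset.range T, d (k + t) := Finset.sum_nonneg fun t _ => hd _
    have hsq := window_sq_le hc hdec T k
    have hl := hL k hk
    have ht := mul_sub_le_rpow_mul_sub (he k) (he (k + T)) h0 h1
    have hΔ : 0 ≤ e k ^ (1 - τ) - e (k + T) ^ (1 - τ) :=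
      sub_nonneg.2 (Real.rpow_le_rpow (he _) (hanti (Nat.le_add_right k T)) h1'.le)
    generalize (∑ t ∈ Finset.range T, d (k + t)) = W at *
    generalize e k ^ (1 - τ) - e (k + T) ^ (1 - τ) = Δ at *
    rcases hW.eq_or_lt with h | h
    · rw [← h]; positivity
    have h3 : (1 - τ) * (e k - e (k + T)) ≤ B * W * Δ := ht.trans (by gcongr)
    have h4 : (c * (1 - τ) * W) * W ≤ (T * B * Δ) * W := by
      calc (c * (1 - τ) * W) * W = (1 - τ) * (c * W ^ 2) := by ring
        _ ≤ (1 - τ) * (T * (e k - e (k + T))) := by gcongr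
        _ = T * ((1 - τ) * (e k - e (k + T))) := by ring
        _ ≤ T * (B * W * Δ) := by gcongr
        _ = _ := by ring
    have h5 := le_of_mul_le_mul_right h4 h
    rw [hC, div_mul_eq_mul_div, le_div_iff₀ (by positivity)]
    linarith
  have hmul : ∀ k ≥ K, ∀ j : ℕ, ∑ t ∈ Finset.range (j * T), d (k + t) ≤
      C * (e k ^ (1 - τ) - e (k + j * T) ^ (1 - τ)) := by
    intro k hk j
    induction j with
    | zero => simp
    | succ j ih =>
      rw [Nat.succ_mul, Finset.sum_range_add]
      have := hwin (k + j * T) (by omega)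
      simp only [← add_assoc] at *
      linarith
  refine ⟨C, hC0.le, fun k hk m => ?_⟩
  calc ∑ t ∈ Finset.range m, d (k + t) ≤ ∑ t ∈ Finset.range (m * T), d (k + t) :=
        Finset.sum_le_sum_of_subset_of_nonneg
          (Finset.range_subset_range.2 (Nat.le_mul_of_pos_right m hT)) fun t _ _ => hd _
    _ ≤ C * (e k ^ (1 - τ) - e (k + m * T) ^ (1 - τ)) := hmul k hk m
    _ ≤ C * e k ^ (1 - τ) := by
        have := Real.rpow_nonneg (he (k + m * T)) (1 - τ)
        gcongr; linarith

lemma exists_le_mul_pow_of_eventually {a : ℕ → ℝ} {C r : ℝ} (K : ℕ) (hr : 0 < r)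
    (h : ∀ k ≥ K, a k ≤ C * r ^ k) : ∃ C' : ℝ, ∀ k, a k ≤ C' * r ^ k := by
  obtain ⟨M, hM⟩ := ((Finset.range K).image fun k => a k / r ^ k).bddAbove
  refine ⟨max C M, fun k => ?_⟩
  have hrk : 0 < r ^ k := pow_pos hr k
  by_cases hk : K ≤ k
  · exact (h k hk).trans (by gcongr; exact le_max_left _ _)
  · have : a k / r ^ k ≤ M := hM (by
      rw [Finset.mem_coe, Finset.mem_image]
      exact ⟨k, Finset.mem_range.2 (by omega), rfl⟩)
    rw [div_le_iff₀ hrk] at this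
    exact this.trans (by gcongr; exact le_max_right _ _)

/-- A fixed-factor contraction over every window of length `T` is geometric decay. -/
lemma exists_geometric_of_window_contraction {e : ℕ → ℝ} {q : ℝ} {T K : ℕ} (hT : 1 ≤ T)
    (hq0 : 0 < q) (hq1 : q < 1) (h : ∀ k ≥ K, e (k + T) ≤ q * e k) :
    ∃ C r : ℝ, 0 < r ∧ r < 1 ∧ ∀ k, e k ≤ C * r ^ k := by
  have hTr : (0 : ℝ) < (T : ℝ)⁻¹ := inv_pos.2 (by exact_mod_cast hT)
  set r := q ^ (T : ℝ)⁻¹ with hr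
  have hr0 : 0 < r := Real.rpow_pos_of_pos hq0 _
  have hrT : r ^ T = q := Real.rpow_inv_natCast_pow hq0.le (by omega)
  obtain ⟨M, hM⟩ := ((Finset.range (K + T)).image fun k => e k / r ^ k).bddAbove
  refine ⟨M, r, hr0, Real.rpow_lt_one hq0.le hq1 hTr, fun k => ?_⟩
  induction k using Nat.strong_induction_on with
  | _ k ih =>
    by_cases hk : k < K + T
    · rw [← div_le_iff₀ (pow_pos hr0 k)]
      exact hM (by
        rw [Finset.mem_coe, Finset.mem_image]
        exact ⟨k, Finset.mem_range.2 hk, rfl⟩)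
    · obtain ⟨j, rfl⟩ : ∃ j, k = j + T := ⟨k - T, by omega⟩
      calc e (j + T) ≤ q * e j := h j (by omega)
        _ ≤ q * (M * r ^ j) := by gcongr; exact ih j (by omega)
        _ = M * r ^ (j + T) := by rw [pow_add, hrT]; ring

/-- With exponent `1/2` the Łojasiewicz argument gives geometric decay of `√(e k)`: there
`e k ≤ B² W² ≤ (B² T / c) (e k - e (k + T))`. -/
theorem exists_sqrt_le_geometric_of_lojasiewicz {e d : ℕ → ℝ} {c B : ℝ} {T K : ℕ} (hT : 1 ≤ T)
    (hc : 0 < c) (hB : 0 < B) (he : ∀ k, 0 ≤ e k)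
    (hdec : ∀ k, e (k + 1) + c * d k ^ 2 ≤ e k)
    (hL : ∀ k ≥ K, √(e k) ≤ B * ∑ t ∈ Finset.range T, d (k + t)) :
    ∃ C r : ℝ, 0 < r ∧ r < 1 ∧ ∀ k, √(e k) ≤ C * r ^ k := by
  have hT0 : (0 : ℝ) < T := by exact_mod_cast hT
  set A := B ^ 2 * T / c with hA
  have hA0 : 0 < A := by positivity
  have hcontr : ∀ k ≥ K, e (k + T) ≤ (A / (1 + A)) * e k := by
    intro k hk
    have hsq := window_sq_le hc hdec T k
    have hl := pow_le_pow_left₀ (Real.sqrt_nonneg _) (hL k hk) 2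
    rw [Real.sq_sqrt (he k), mul_pow] at hl
    have h1 : e k ≤ A * (e k - e (k + T)) := by
      rw [hA, div_mul_eq_mul_div, le_div_iff₀ hc]
      nlinarith [mul_le_mul_of_nonneg_left hsq (sq_nonneg B)]
    rw [div_mul_eq_mul_div, le_div_iff₀ (by positivity)]
    -- the factor `A / (1 + A)` instead of `1 - 1 / A` is positive whatever `A` is
    nlinarith [he (k + T), antitone_of_sufficient_decrease hc hdec (Nat.le_add_right k T)]
  obtain ⟨C, r, hr0, hr1, h⟩ := exists_geometric_of_window_contraction hT (by positivity)
    ((div_lt_one (by positivity)).2 (by linarith)) hcontr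
  refine ⟨√C, √r, Real.sqrt_pos.2 hr0, by rw [Real.sqrt_lt' one_pos]; simpa using hr1,
    fun k => ?_⟩
  have hC : 0 ≤ C := by simpa using (he 0).trans (h 0)
  calc √(e k) ≤ √(C * r ^ k) := Real.sqrt_le_sqrt (h k)
    _ = √C * √r ^ k := by
      rw [Real.sqrt_mul hC]
      congr 1
      rw [Real.sqrt_eq_iff_mul_self_eq (by positivity) (by positivity), ← mul_pow,
        Real.mul_self_sqrt hr0.le]

/-! ### Subgradients and the KL inequality -/

section Subgradients

lemma ne_top_of_add_coe_le {X : Type*} {h : X → EReal} {z w : X} {q r : ℝ}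
    (hle : h z + (q : EReal) ≤ h w + (r : EReal)) (hw : h w ≠ ⊤) : h z ≠ ⊤ := by
  intro htop
  rw [htop, EReal.top_add_coe, top_le_iff] at hle
  exact (EReal.add_lt_top hw (EReal.coe_ne_top _)).ne hle

variable {V : Type*} [NormedAddCommGroup V] [InnerProductSpace ℝ V]

lemma regSubdiff_subset_limSubdiff (h : V → EReal) (x : V) :
    BCPG.regSubdiff h x ⊆ BCPG.limSubdiff h x := fun v hv =>
  ⟨hv.1, fun _ => x, fun _ => v, tendsto_const_nhds, tendsto_const_nhds, fun _ => hv,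
    tendsto_const_nhds⟩

lemma mem_regSubdiff_of_quadratic_minorant {h : V → EReal} {x v : V} {a C : ℝ} (hx : h x = a)
    (hq : ∀ w, ((a + inner ℝ v (w - x) - C * ‖w - x‖ ^ 2 : ℝ) : EReal) ≤ h w) :
    v ∈ BCPG.regSubdiff h x := by
  refine ⟨⟨by simp [hx], by simp [hx]⟩, fun ε hε => ?_⟩
  have hlim : Tendsto (fun y => C * ‖y - x‖) (𝓝 x) (𝓝 0) := by
    have : Continuous fun y => C * ‖y - x‖ := by fun_prop
    simpa using this.tendsto x
  filter_upwards [hlim.eventually_lt_const hε] with y hy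
  refine le_trans ?_ (hq y)
  rw [hx, ← EReal.coe_add, EReal.coe_le_coe_iff]
  nlinarith [mul_le_mul_of_nonneg_right hy.le (norm_nonneg (y - x))]

/-- The KL inequality in real terms: near `a`, the power `(h w - h a) ^ θ` is at most a multiple of
the norm of any regular subgradient at `w`. -/
lemma exists_rpow_le_norm_of_hasKLAt {h : V → EReal} {θ : ℝ} {a : V} {b : ℝ}
    (hKL : BCPG.HasKLAt h θ a) (hθ : θ < 1) (ha : h a = b) :
    ∃ ε > (0 : ℝ), ∃ η > (0 : ℝ), ∃ B > (0 : ℝ), ∀ (w v : V) (r : ℝ), ‖w - a‖ < ε → h w = r →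
      b < r → r < b + η → v ∈ BCPG.regSubdiff h w → (r - b) ^ θ ≤ B * ‖v‖ := by
  obtain ⟨ε, hε, η, hη, ρ, hρ, H⟩ := hKL
  have hθ' : 0 < 1 - θ := sub_pos.2 hθ
  refine ⟨ε, hε, η, hη, ρ * (1 - θ), by positivity, fun w v r hw hr hbr hrη hv => ?_⟩
  have h1 := H w hw (by rw [ha, hr]; exact_mod_cast hbr)
    (by rw [ha, hr]; exact_mod_cast hrη)
  have ht : 0 < r - b := sub_pos.2 hbr
  have hder : deriv (fun s : ℝ => ρ * s ^ (1 - θ)) (r - b) = ρ * ((1 - θ) * (r - b) ^ (-θ)) := by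
    have := ((Real.hasDerivAt_rpow_const (p := 1 - θ) (Or.inl ht.ne')).const_mul ρ).deriv
    rw [this]
    congr 3
    ring
  have hsub : (h w - h a).toReal = r - b := by
    rw [hr, ha, ← EReal.coe_sub, EReal.toReal_coe]
  rw [hsub, hder] at h1
  have h2 : Metric.infEDist (0 : V) (BCPG.limSubdiff h w) ≤ ENNReal.ofReal ‖v‖ := by
    refine (Metric.infEDist_le_edist_of_mem (regSubdiff_subset_limSubdiff h w hv)).trans ?_
    rw [edist_dist, dist_zero_left]
  have h3 := h1.trans (mul_le_mul_right h2 _)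
  rw [← ENNReal.ofReal_mul (by positivity), ENNReal.one_le_ofReal] at h3
  have hpow : 0 < (r - b) ^ θ := Real.rpow_pos_of_pos ht θ
  rw [Real.rpow_neg ht.le] at h3
  calc (r - b) ^ θ ≤ (r - b) ^ θ * (ρ * ((1 - θ) * ((r - b) ^ θ)⁻¹) * ‖v‖) :=
        le_mul_of_one_le_right hpow.le h3
    _ = ρ * (1 - θ) * ‖v‖ := by field_simp

/-- If `a ≤ s + C t ^ 2` with `t, s ≤ 1`, the exponent `τ = max θ (1/2)` is the one for which both
a Łojasiewicz bound `s ^ θ ≤ B t` and the quadratic error are absorbed by a multiple of `t`. -/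
lemma rpow_max_half_le {a s t θ B C : ℝ} (hθ1 : θ < 1) (ha : 0 ≤ a) (ht : 0 ≤ t)
    (ht1 : t ≤ 1) (hs1 : s ≤ 1) (hB : 0 ≤ B) (hC : 0 ≤ C) (has : a ≤ s + C * t ^ 2)
    (hs : 0 < s → s ^ θ ≤ B * t) :
    a ^ max θ (1 / 2) ≤ (B + C ^ max θ (1 / 2)) * t := by
  set τ := max θ (1 / 2) with hτ
  have hτ2 : 1 / 2 ≤ τ := le_max_right _ _
  have hτ0 : 0 < τ := by linarith
  have hτ1 : τ ≤ 1 := max_le hθ1.le (by norm_num)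
  have hquad : (C * t ^ 2) ^ τ ≤ C ^ τ * t := by
    rw [Real.mul_rpow hC (by positivity)]
    gcongr
    rcases ht.eq_or_lt with h | h
    · rw [← h]; simp [hτ0.ne']
    · rw [← Real.rpow_natCast, ← Real.rpow_mul ht]
      calc t ^ (((2 : ℕ) : ℝ) * τ) ≤ t ^ (1 : ℝ) :=
            Real.rpow_le_rpow_of_exponent_ge h ht1 (by push_cast; linarith)
        _ = t := Real.rpow_one t
  rcases le_or_gt s 0 with h | h
  · calc a ^ τ ≤ (C * t ^ 2) ^ τ := Real.rpow_le_rpow ha (by linarith) hτ0.le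
      _ ≤ C ^ τ * t := hquad
      _ ≤ (B + C ^ τ) * t := by gcongr; linarith
  · calc a ^ τ ≤ (s + C * t ^ 2) ^ τ := Real.rpow_le_rpow ha has hτ0.le
      _ ≤ s ^ τ + (C * t ^ 2) ^ τ :=
        Real.rpow_add_le_add_rpow h.le (by positivity) hτ0.le hτ1
      _ ≤ s ^ θ + (C * t ^ 2) ^ τ :=
        add_le_add (Real.rpow_le_rpow_of_exponent_ge h hs1 (le_max_left _ _)) le_rfl
      _ ≤ B * t + C ^ τ * t := add_le_add (hs h) hquad
      _ = (B + C ^ τ) * t := by ring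

end Subgradients

/-! ### Convergence of model descent sequences -/

/-- Sequences `x`, `z` in which `z k` minimizes the model `w ↦ P w + D w (x k)` of `P` at `x k` and
`x (k + 1)` is a point at which the model value of `z k` has dropped by `c ‖x (k + 1) - x k‖ ^ 2`.
The function `D` plays the role of a Bregman distance (`S z y` is the difference at `z` and `y` of
the gradients of its kernel), `T` is the length of the window of steps that bounds the residual
`z k - x k`, and `C` is a common upper bound for the constants involved. -/
structure IsModelDescent {V : Type*} [NormedAddCommGroup V] [InnerProductSpace ℝ V]
    (P : V → EReal) (D : V → V → ℝ) (S : V → V → V) (c C : ℝ) (T : ℕ) (x z : ℕ → V) : Prop where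
  pos : 0 < c
  pos' : 0 < C
  one_le : 1 ≤ T
  nonneg : ∀ w y, 0 ≤ D w y
  le_sq : ∀ w y, D w y ≤ C * ‖w - y‖ ^ 2
  continuous_right : ∀ w, Continuous (D w)
  three_point : ∀ w z y, D w y = D z y + D w z + inner ℝ (S z y) (w - z)
  norm_le : ∀ z y, ‖S z y‖ ≤ C * ‖z - y‖
  minimal : ∀ k w, P (z k) + (D (z k) (x k) : EReal) ≤ P w + (D w (x k) : EReal)
  decrease : ∀ k, D (z k) (x (k + 1)) + c * ‖x (k + 1) - x k‖ ^ 2 ≤ D (z k) (x k)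
  residual : ∀ k, ‖z k - x k‖ ≤ C * ∑ t ∈ Finset.range T, ‖x (k + t + 1) - x (k + t)‖

namespace IsModelDescent

variable {V : Type*} [NormedAddCommGroup V] [InnerProductSpace ℝ V]
  {P : V → EReal} {D : V → V → ℝ} {S : V → V → V} {c C : ℝ} {T : ℕ} {x z : ℕ → V}

lemma self_eq_zero (h : IsModelDescent P D S c C T x z) (w : V) : D w w = 0 :=
  le_antisymm (by simpa using h.le_sq w w) (h.nonneg w w)

lemma exists_real (h : IsModelDescent P D S c C T x z) (hP : BCPG.IsProper P) :
    ∃ p : ℕ → ℝ, ∀ k, P (z k) = p k := by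
  obtain ⟨w, hw⟩ := hP.2
  exact ⟨fun k => (P (z k)).toReal, fun k =>
    (EReal.coe_toReal (ne_top_of_add_coe_le (h.minimal k w) hw) (hP.1 _)).symm⟩

/-- The model values `P (z k) + D (z k) (x k)` decrease sufficiently. -/
lemma sufficient_decrease (h : IsModelDescent P D S c C T x z) {p : ℕ → ℝ}
    (hp : ∀ k, P (z k) = p k) (k : ℕ) :
    p (k + 1) + D (z (k + 1)) (x (k + 1)) + c * ‖x (k + 1) - x k‖ ^ 2 ≤
      p k + D (z k) (x k) := by
  have h1 := h.minimal (k + 1) (z k)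
  rw [hp, hp] at h1
  have h2 : p (k + 1) + D (z (k + 1)) (x (k + 1)) ≤ p k + D (z k) (x (k + 1)) := by
    exact_mod_cast h1
  linarith [h.decrease k]

lemma mem_regSubdiff_of_minimal (h : IsModelDescent P D S c C T x z) (hP : BCPG.IsProper P)
    {a y : V} {b : ℝ} (ha : P a = b)
    (hmin : ∀ w, P a + (D a y : EReal) ≤ P w + (D w y : EReal)) :
    -S a y ∈ BCPG.regSubdiff P a := by
  refine mem_regSubdiff_of_quadratic_minorant (C := C) ha fun w => ?_
  by_cases hw : P w = ⊤
  · simp [hw]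
  have h1 := hmin w
  rw [← EReal.coe_toReal hw (hP.1 w)] at h1 ⊢
  rw [ha] at h1
  have h2 : b + D a y ≤ (P w).toReal + D w y := by exact_mod_cast h1
  rw [EReal.coe_le_coe_iff, inner_neg_left]
  linarith [h.three_point w a y, h.le_sq w a]

/-- Every cluster point is stationary, with value the limit of the model values: pass to the limit
in the minimality of `z k`, by semicontinuity on the left and continuity of `D w` on the right. -/
lemma cluster_point (h : IsModelDescent P D S c C T x z) (hP : BCPG.IsProper P)
    (hlsc : LowerSemicontinuous P) {p : ℕ → ℝ} (hp : ∀ k, P (z k) = p k) {φ : ℝ}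
    (hφ : Tendsto (fun k => p k + D (z k) (x k)) atTop (𝓝 φ)) (hpφ : Tendsto p atTop (𝓝 φ))
    (hr : Tendsto (fun k => z k - x k) atTop (𝓝 0)) {σ : ℕ → ℕ} (hσ : Tendsto σ atTop atTop)
    {a : V} (ha : Tendsto (z ∘ σ) atTop (𝓝 a)) :
    P a = φ ∧ BCPG.IsStationary P a := by
  have hxa : Tendsto (fun j => x (σ j)) atTop (𝓝 a) := by
    simpa using ha.sub (hr.comp hσ)
  have hmin : ∀ w b, P w = ((b : ℝ) : EReal) → φ ≤ b + D w a := by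
    intro w b hb
    refine le_of_tendsto_of_tendsto' (hφ.comp hσ)
      ((((h.continuous_right w).tendsto a).comp hxa).const_add b) fun j => ?_
    have := h.minimal (σ j) w
    rw [hp, hb] at this
    exact_mod_cast this
  have hle : P a ≤ φ := by
    by_contra! hlt
    obtain ⟨y, hy1, hy2⟩ := EReal.lt_iff_exists_real_btwn.1 hlt
    have hev := ha.eventually (hlsc a y hy2)
    have : y ≤ φ := ge_of_tendsto (hpφ.comp hσ) (hev.mono fun j hj => by
      simp only [Function.comp_apply, hp] at hj
      exact_mod_cast hj.le)
    exact absurd hy1 (by simpa using this)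
  have hfin : P a = ((P a).toReal : EReal) :=
    (EReal.coe_toReal (hle.trans_lt (EReal.coe_lt_top φ)).ne (hP.1 a)).symm
  have heq : P a = φ := by
    refine le_antisymm hle ?_
    have := hmin a _ hfin
    rw [h.self_eq_zero, add_zero] at this
    rw [hfin]
    exact_mod_cast this
  refine ⟨heq, ?_⟩
  have hS : S a a = 0 := by simpa using h.norm_le a a
  have := h.mem_regSubdiff_of_minimal hP (y := a) heq fun w => by
    by_cases hw : P w = ⊤
    · simp [hw]
    have hw' := (EReal.coe_toReal hw (hP.1 w)).symm
    have := hmin w _ hw'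
    rw [heq, hw', h.self_eq_zero]
    exact_mod_cast (by linarith : φ + 0 ≤ _)
  simpa [BCPG.IsStationary, hS] using this

/-- The KL inequality holds along the tail of the sequence with one constant: a subsequence on which
the constants blow up would have a cluster point, contradicting the inequality there. -/
lemma exists_lojasiewicz (h : IsModelDescent P D S c C T x z) (hP : BCPG.IsProper P)
    {p : ℕ → ℝ} (hp : ∀ k, P (z k) = p k) {φ θ : ℝ} (hθ : θ < 1)
    (hpφ : Tendsto p atTop (𝓝 φ)) {s : Set V} (hs : IsCompact s) (hzs : ∀ k, z k ∈ s)
    (hcl : ∀ (σ : ℕ → ℕ) (a : V), Tendsto σ atTop atTop → Tendsto (z ∘ σ) atTop (𝓝 a) →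
      P a = φ ∧ BCPG.IsStationary P a) (hKL : BCPG.HasKL P θ) :
    ∃ B > (0 : ℝ), ∃ K, ∀ k ≥ K, φ < p k → (p k - φ) ^ θ ≤ B * ‖z k - x k‖ := by
  by_contra! hcon
  choose κ hκ1 hκ2 hκ3 using fun m : ℕ => hcon (m + 1) (by positivity) m
  obtain ⟨a, -, ν, hν, ha⟩ := hs.tendsto_subseq fun m => hzs (κ m)
  have hκ : Tendsto κ atTop atTop := tendsto_atTop_mono hκ1 tendsto_id
  have hσ : Tendsto (κ ∘ ν) atTop atTop := hκ.comp hν.tendsto_atTop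
  obtain ⟨haφ, hst⟩ := hcl (κ ∘ ν) a hσ ha
  obtain ⟨ε, hε, η, hη, B, hB, H⟩ := exists_rpow_le_norm_of_hasKLAt
    (hKL a ⟨0, regSubdiff_subset_limSubdiff P a hst⟩) hθ haφ
  have hC := h.pos'
  obtain ⟨M, hM⟩ := exists_nat_gt (B * C)
  have e1 : ∀ᶠ j in atTop, ‖z (κ (ν j)) - a‖ < ε := by
    filter_upwards [ha.eventually (Metric.ball_mem_nhds a hε)] with j hj
    simpa [dist_eq_norm] using hj
  have e2 : ∀ᶠ j in atTop, p (κ (ν j)) < φ + η :=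
    (hpφ.comp hσ).eventually_lt_const (by linarith)
  obtain ⟨j, h1, h2, h3⟩ := (e1.and (e2.and (hν.tendsto_atTop.eventually_ge_atTop M))).exists
  have h4 := H _ _ _ h1 (hp _) (hκ2 _) h2
    (h.mem_regSubdiff_of_minimal hP (hp _) (h.minimal _))
  refine absurd (hκ3 (ν j)) (not_lt.2 (h4.trans ?_))
  rw [norm_neg]
  calc B * ‖S (z (κ (ν j))) (x (κ (ν j)))‖ ≤ B * (C * ‖z (κ (ν j)) - x (κ (ν j))‖) := by
        gcongr; exact h.norm_le _ _
    _ = (B * C) * ‖z (κ (ν j)) - x (κ (ν j))‖ := by ring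
    _ ≤ ((ν j : ℝ) + 1) * ‖z (κ (ν j)) - x (κ (ν j))‖ := by
        gcongr
        have : (M : ℝ) ≤ ν j := by exact_mod_cast h3
        linarith

/-- Under the KL property and coercivity, model descent sequences have finite length, converge to a
common stationary point, and do so R-linearly if the exponent is at most `1/2`. -/
theorem convergence [ProperSpace V] (h : IsModelDescent P D S c C T x z) (hP : BCPG.IsProper P)
    (hlsc : LowerSemicontinuous P) (hmin : (BCPG.argminSet P).Nonempty)
    (hcoer : BCPG.IsCoercive P) {θ : ℝ} (hθ : θ < 1) (hKL : BCPG.HasKL P θ) :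
    ∃ a : V, BCPG.IsStationary P a ∧ Tendsto x atTop (𝓝 a) ∧ Tendsto z atTop (𝓝 a) ∧
      (θ ≤ 1 / 2 → BCPG.ConvergesRLinearly (fun k => ‖z k - x k‖) 0 ∧
        BCPG.ConvergesRLinearly x a ∧ BCPG.ConvergesRLinearly z a) := by
  have hc := h.pos
  have hC := h.pos'
  obtain ⟨p, hp⟩ := h.exists_real hP
  have hdec := h.sufficient_decrease hp
  have hanti := antitone_of_sufficient_decrease hc (e := fun k => p k + D (z k) (x k)) hdec
  -- The model values are bounded below by the minimum of `P`, so they converge.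
  obtain ⟨m, hm⟩ : ∃ m : ℝ, ∀ k, m ≤ p k := by
    obtain ⟨y, hy⟩ := hmin
    have hyt : P y ≠ ⊤ := by
      obtain ⟨w, hw⟩ := hP.2
      exact ((hy w).trans_lt (lt_top_iff_ne_top.2 hw)).ne
    refine ⟨(P y).toReal, fun k => ?_⟩
    rw [← EReal.coe_le_coe_iff, EReal.coe_toReal hyt (hP.1 y), ← hp]
    exact hy _
  obtain ⟨φ, hφ, hφle⟩ : ∃ φ, Tendsto (fun k => p k + D (z k) (x k)) atTop (𝓝 φ) ∧
      ∀ k, φ ≤ p k + D (z k) (x k) := by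
    have hbdd : BddBelow (Set.range fun k => p k + D (z k) (x k)) :=
      ⟨m, by rintro _ ⟨k, rfl⟩; exact (hm k).trans (by linarith [h.nonneg (z k) (x k)])⟩
    exact ⟨_, tendsto_atTop_ciInf hanti hbdd, fun k => ciInf_le hbdd k⟩
  -- The steps and the residuals vanish.
  have hd0 : Tendsto (fun k => ‖x (k + 1) - x k‖) atTop (𝓝 0) := by
    have h1 : Tendsto (fun k => (p k + D (z k) (x k) -
        (p (k + 1) + D (z (k + 1)) (x (k + 1)))) / c) atTop (𝓝 0) := by
      simpa using (hφ.sub (hφ.comp (tendsto_add_atTop_nat 1))).div_const c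
    have h2 : Tendsto (fun k => ‖x (k + 1) - x k‖ ^ 2) atTop (𝓝 0) :=
      squeeze_zero (fun k => by positivity) (fun k => by
        rw [le_div_iff₀ hc]; linarith [hdec k]) h1
    simpa [Real.sqrt_sq] using h2.sqrt
  have hr0 : Tendsto (fun k => ‖z k - x k‖) atTop (𝓝 0) := by
    refine squeeze_zero (fun k => norm_nonneg _) h.residual ?_
    have := (tendsto_finsetSum (Finset.range T) fun t _ =>
      hd0.comp (tendsto_add_atTop_nat t)).const_mul C
    simpa using this
  have hr : Tendsto (fun k => z k - x k) atTop (𝓝 0) := tendsto_zero_iff_norm_tendsto_zero.2 hr0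
  have hD0 : Tendsto (fun k => D (z k) (x k)) atTop (𝓝 0) :=
    squeeze_zero (fun k => h.nonneg _ _) (fun k => h.le_sq _ _) (by
      simpa using (hr0.pow 2).const_mul C)
  have hpφ : Tendsto p atTop (𝓝 φ) := by simpa using hφ.sub hD0
  -- By coercivity the sequence `z` stays in a compact set.
  obtain ⟨R, hR⟩ : ∃ R, ∀ k, z k ∈ Metric.closedBall (0 : V) R := by
    have hev : ∀ᶠ w in Bornology.cobounded V,
        ((p 0 + D (z 0) (x 0) : ℝ) : EReal) < P w :=
      hcoer.eventually_const_lt (EReal.coe_lt_top _)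
    have hb : Bornology.IsBounded {w | P w ≤ ((p 0 + D (z 0) (x 0) : ℝ) : EReal)} := by
      rw [← Bornology.isCobounded_compl_iff]
      filter_upwards [hev] with w hw
      simpa using hw
    obtain ⟨R, hR⟩ := hb.subset_closedBall 0
    refine ⟨R, fun k => hR ?_⟩
    rw [Set.mem_ofPred_eq, hp, EReal.coe_le_coe_iff]
    linarith [hanti (Nat.zero_le k), h.nonneg (z k) (x k)]
  have hcl : ∀ (σ : ℕ → ℕ) (a : V), Tendsto σ atTop atTop → Tendsto (z ∘ σ) atTop (𝓝 a) →
      P a = φ ∧ BCPG.IsStationary P a := fun σ a hσ ha =>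
    h.cluster_point hP hlsc hp hφ hpφ hr hσ ha
  obtain ⟨B, hB, K₁, hBK⟩ := h.exists_lojasiewicz hP hp hθ hpφ
    (isCompact_closedBall (0 : V) R) hR hcl hKL
  set τ := max θ (1 / 2) with hτ
  have hτ0 : 0 < τ := lt_max_of_lt_right (by norm_num)
  have hτ1 : τ < 1 := max_lt hθ (by norm_num)
  set e : ℕ → ℝ := fun k => p k + D (z k) (x k) - φ with he
  have he0 : ∀ k, 0 ≤ e k := fun k => sub_nonneg.2 (hφle k)
  have hedec : ∀ k, e (k + 1) + c * ‖x (k + 1) - x k‖ ^ 2 ≤ e k := fun k => by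
    simp only [he]; linarith [hdec k]
  set A := (B + C ^ τ) * C with hA
  have hA0 : 0 < A := by positivity
  obtain ⟨K, hK⟩ : ∃ K, ∀ k ≥ K,
      e k ^ τ ≤ A * ∑ t ∈ Finset.range T, ‖x (k + t + 1) - x (k + t)‖ := by
    have e1 : ∀ᶠ k in atTop, ‖z k - x k‖ < 1 := hr0.eventually_lt_const one_pos
    have e2 : ∀ᶠ k in atTop, p k < φ + 1 := hpφ.eventually_lt_const (by linarith)
    obtain ⟨K, hK⟩ := eventually_atTop.1 (e1.and (e2.and (eventually_ge_atTop K₁)))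
    refine ⟨K, fun k hk => ?_⟩
    obtain ⟨h1, h2, h3⟩ := hK k hk
    have h4 := rpow_max_half_le (s := p k - φ) hθ (he0 k) (norm_nonneg (z k - x k)) h1.le
      (by linarith) hB.le hC.le (by simp only [he]; linarith [h.le_sq (z k) (x k)])
      fun hpos => hBK k h3 (sub_pos.1 hpos)
    calc e k ^ τ ≤ (B + C ^ τ) * ‖z k - x k‖ := h4
      _ ≤ (B + C ^ τ) * (C * ∑ t ∈ Finset.range T, ‖x (k + t + 1) - x (k + t)‖) := by
        gcongr; exact h.residual k
      _ = _ := by rw [hA]; ring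
  obtain ⟨Q, hQ0, hQ⟩ := exists_sum_le_rpow_of_lojasiewicz h.one_le hc hA0 he0
    (fun k => norm_nonneg (x (k + 1) - x k)) hτ0 hτ1 hedec hK
  -- Finite length makes `x` converge, with error at most the tail of the length.
  have hsum : Summable fun k => dist (x k) (x k.succ) := by
    rw [← summable_nat_add_iff K]
    refine summable_of_sum_range_le (c := Q * e K ^ (1 - τ)) (fun _ => dist_nonneg) fun j => ?_
    refine le_of_eq_of_le (Finset.sum_congr rfl fun t _ => ?_) (hQ K le_rfl j)
    rw [dist_comm, dist_eq_norm, add_comm t K, Nat.succ_eq_add_one]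
  obtain ⟨a, ha⟩ := cauchySeq_tendsto_of_complete (cauchySeq_of_summable_dist hsum)
  have hza : Tendsto z atTop (𝓝 a) := by simpa using hr.add ha
  refine ⟨a, (hcl id a tendsto_id hza).2, ha, hza, fun hθ2 => ?_⟩
  have hτ2 : τ = 1 / 2 := max_eq_right hθ2
  have hxk : ∀ k ≥ K, dist (x k) a ≤ Q * √(e k) := by
    intro k hk
    refine le_of_tendsto (tendsto_const_nhds.dist (ha.comp (tendsto_add_atTop_nat k)))
      (Eventually.of_forall fun j => ?_)
    have h1 := dist_le_range_sum_dist (fun t => x (k + t)) j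
    have h2 := hQ k hk j
    rw [hτ2, (by norm_num : (1 : ℝ) - 1 / 2 = 1 / 2), ← Real.sqrt_eq_rpow] at h2
    simp only [Function.comp_apply, add_comm j k]
    refine h1.trans (le_of_eq_of_le (Finset.sum_congr rfl fun t _ => ?_) h2)
    rw [dist_comm, dist_eq_norm, add_assoc]
  have hrk : ∀ k ≥ K, ‖z k - x k‖ ≤ (C * Q) * √(e k) := by
    intro k hk
    have h2 := hQ k hk T
    rw [hτ2, (by norm_num : (1 : ℝ) - 1 / 2 = 1 / 2), ← Real.sqrt_eq_rpow] at h2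
    calc _ ≤ C * ∑ t ∈ Finset.range T, ‖x (k + t + 1) - x (k + t)‖ := h.residual k
      _ ≤ C * (Q * √(e k)) := by gcongr
      _ = _ := by ring
  obtain ⟨M, r, hr0', hr1, hM⟩ := exists_sqrt_le_geometric_of_lojasiewicz h.one_le hc hA0 he0
    hedec fun k hk => by rw [Real.sqrt_eq_rpow, ← hτ2]; exact hK k hk
  have key : ∀ (u : ℕ → ℝ) (q : ℝ), 0 ≤ q → (∀ k ≥ K, u k ≤ q * √(e k)) →
      ∃ C', ∀ k, u k ≤ C' * r ^ k := fun u q hq hu =>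
    exists_le_mul_pow_of_eventually (C := q * M) K hr0' fun k hk =>
      (hu k hk).trans (by rw [mul_assoc]; gcongr; exact hM k)
  obtain ⟨C₁, h₁⟩ := key _ _ (by positivity) hrk
  obtain ⟨C₂, h₂⟩ := key _ _ hQ0 hxk
  refine ⟨⟨C₁, r, hr0', hr1, fun k => by simpa using h₁ k⟩, ⟨C₂, r, hr0', hr1, h₂⟩,
    ⟨C₁ + C₂, r, hr0', hr1, fun k => ?_⟩⟩
  rw [add_mul]
  refine (dist_triangle _ (x k) _).trans (add_le_add ?_ (h₂ k))
  rw [dist_eq_norm]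
  exact h₁ k

end IsModelDescent

/-! ### The proximal mapping of a convex function -/

section Prox

variable {V : Type*} [NormedAddCommGroup V] [InnerProductSpace ℝ V]

/-- The optimality condition for the proximal mapping: `A (u - z)` is a convex subgradient at `z`.
Minimality of `z` is tested on the segment from `z` to `w`, near `z`. -/
lemma add_inner_le_of_mem_prox {A : V →ₗ[ℝ] V} (hA : A.IsSymmetric) {h : V → EReal}
    (hconv : BCPG.IsConvex h) {u z w : V} (hz : z ∈ BCPG.prox A h u) {a b : ℝ} (ha : h z = a)
    (hb : h w = b) : a + inner ℝ (A (u - z)) (w - z) ≤ b := by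
  set Q := inner ℝ (w - z) (A (w - z)) with hQ
  have hlim : Tendsto (fun t : ℝ => t / 2 * Q) (𝓝[>] 0) (𝓝 0) := by
    have : Continuous fun t : ℝ => t / 2 * Q := by fun_prop
    simpa using (this.tendsto 0).mono_left nhdsWithin_le_nhds
  suffices a + inner ℝ (A (u - z)) (w - z) - b ≤ 0 by linarith
  refine ge_of_tendsto hlim ?_
  filter_upwards [Ioo_mem_nhdsGT (one_pos : (0 : ℝ) < 1)] with t ht
  have hy : h ((1 - t) • z + t • w) ≤ (((1 - t) * a + t * b : ℝ) : EReal) :=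
    hconv (x := (z, a)) ha.le (y := (w, b)) hb.le (sub_nonneg.2 ht.2.le) ht.1.le (by ring)
  have h1 := (hz ((1 - t) • z + t • w)).trans (add_le_add_left hy _)
  simp only [ha] at h1
  rw [← EReal.coe_add, ← EReal.coe_add, EReal.coe_le_coe_iff] at h1
  have h2 : (1 - t) • z + t • w - u = (z - u) + t • (w - z) := by module
  have h3 : inner ℝ (w - z) (A (z - u)) = - inner ℝ (A (u - z)) (w - z) := by
    rw [real_inner_comm, ← inner_neg_left, ← map_neg, neg_sub]
  have h4 : inner ℝ (z - u) (A (w - z)) = - inner ℝ (A (u - z)) (w - z) := by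
    rw [← hA, ← inner_neg_left, ← map_neg, neg_sub]
  rw [h2, map_add, map_smul, inner_add_left, inner_add_right, inner_add_right, inner_smul_left,
    inner_smul_right, inner_smul_left, inner_smul_right, h3, h4, ← hQ] at h1
  simp only [conj_trivial] at h1
  have h5 : t * (a + inner ℝ (A (u - z)) (w - z) - b) ≤ t * (t / 2 * Q) := by linarith
  exact le_of_mul_le_mul_left h5 ht.1

/-- The proximal mapping of a convex function in a nondegenerate metric is Lipschitz. -/
lemma norm_sub_le_of_mem_prox {A : V →ₗ[ℝ] V} (hA : A.IsSymmetric) {c K : ℝ} (hc : 0 < c)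
    (hcoer : ∀ v, c * ‖v‖ ^ 2 ≤ inner ℝ (A v) v) (hK : ∀ v, ‖A v‖ ≤ K * ‖v‖) {h : V → EReal}
    (hP : BCPG.IsProper h) (hconv : BCPG.IsConvex h) {u u' z z' : V} (hz : z ∈ BCPG.prox A h u)
    (hz' : z' ∈ BCPG.prox A h u') : ‖z - z'‖ ≤ K / c * ‖u - u'‖ := by
  obtain ⟨w, hw⟩ := hP.2
  have ha := (EReal.coe_toReal (ne_top_of_add_coe_le (hz w) hw) (hP.1 z)).symm
  have ha' := (EReal.coe_toReal (ne_top_of_add_coe_le (hz' w) hw) (hP.1 z')).symm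
  have h1 := add_inner_le_of_mem_prox hA hconv hz ha ha'
  have h2 := add_inner_le_of_mem_prox hA hconv hz' ha' ha
  have h3 : inner ℝ (A (z - z')) (z - z') ≤ inner ℝ (u - u') (A (z - z')) := by
    rw [← hA]
    have e1 : z' - z = -(z - z') := by abel
    rw [e1, inner_neg_right] at h1
    have e2 : inner ℝ (A (u - u')) (z - z') = inner ℝ (A (u - z)) (z - z')
        - inner ℝ (A (u' - z')) (z - z') + inner ℝ (A (z - z')) (z - z') := by
      rw [← inner_sub_left, ← inner_add_left, ← map_sub, ← map_add]
      congr 2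
      abel
    linarith
  have h4 : (c * ‖z - z'‖) * ‖z - z'‖ ≤ (K * ‖u - u'‖) * ‖z - z'‖ :=
    calc (c * ‖z - z'‖) * ‖z - z'‖ = c * ‖z - z'‖ ^ 2 := by ring
      _ ≤ ‖u - u'‖ * ‖A (z - z')‖ := (hcoer _).trans (h3.trans (real_inner_le_norm _ _))
      _ ≤ ‖u - u'‖ * (K * ‖z - z'‖) := by gcongr; exact hK _
      _ = _ := by ring
  rcases (norm_nonneg (z - z')).eq_or_lt with h0 | h0
  · rw [← h0]
    by_cases hs : Subsingleton V
    · simp [Subsingleton.elim u u']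
    · rw [not_subsingleton_iff_nontrivial] at hs
      obtain ⟨v, hv⟩ := exists_ne (0 : V)
      have : 0 ≤ K * ‖v‖ := (norm_nonneg _).trans (hK v)
      have : 0 ≤ K := nonneg_of_mul_nonneg_left this (norm_pos_iff.2 hv)
      positivity
  · rw [div_mul_eq_mul_div, le_div_iff₀ hc, mul_comm]
    exact le_of_mul_le_mul_right h4 h0

end Prox

/-! ### The Bregman distance of a quadratic minus a smooth function -/

section Bregman

variable {E : Type*} [NormedAddCommGroup E] [InnerProductSpace ℝ E] [CompleteSpace E]

/-- The descent lemma: a differentiable function with `L`-Lipschitz gradient differs from its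
linearization by at most `L / 2` times the squared distance. -/
lemma abs_sub_linearization_le {f : E → ℝ} {L : ℝ≥0} (hf : Differentiable ℝ f)
    (hL : LipschitzWith L (gradient f)) (u v : E) :
    |f u - f v - inner ℝ (gradient f v) (u - v)| ≤ L / 2 * ‖u - v‖ ^ 2 := by
  set g : ℝ → ℝ := fun t => f (v + t • (u - v)) - f v - t * inner ℝ (gradient f v) (u - v) with hg
  have hder : ∀ t, HasDerivAt g (inner ℝ (gradient f (v + t • (u - v)) - gradient f v) (u - v))
      t := by
    intro t
    have h1 : HasDerivAt (fun t : ℝ => v + t • (u - v)) (u - v) t := by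
      simpa using ((hasDerivAt_id t).smul_const (u - v)).const_add v
    have h2 := (hf (v + t • (u - v))).hasGradientAt.hasFDerivAt.comp_hasDerivAt t h1
    rw [InnerProductSpace.toDual_apply_apply] at h2
    have h3 := (hasDerivAt_id t).mul_const (inner ℝ (gradient f v) (u - v))
    rw [inner_sub_left]
    rw [one_mul] at h3
    exact (h2.sub_const (f v)).sub h3
  have hB : ∀ t : ℝ, HasDerivAt (fun t : ℝ => L / 2 * ‖u - v‖ ^ 2 * t ^ 2)
      (L * ‖u - v‖ ^ 2 * t) t := fun t => by
    convert! (hasDerivAt_pow 2 t).const_mul (L / 2 * ‖u - v‖ ^ 2) using 1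
    simp; ring
  have key := image_norm_le_of_norm_deriv_right_le_deriv_boundary' (f := g) (a := 0) (b := 1)
    (fun t _ => (hder t).continuousAt.continuousWithinAt) (fun t _ => (hder t).hasDerivWithinAt)
    (by simp [hg]) (fun t _ => (hB t).continuousAt.continuousWithinAt)
    (fun t _ => (hB t).hasDerivWithinAt) (fun t ht => ?_) (Set.right_mem_Icc.2 zero_le_one)
  · simpa [hg] using key
  · have h1 := hL.dist_le_mul (v + t • (u - v)) v
    rw [dist_eq_norm, dist_eq_norm, add_sub_cancel_left, norm_smul, Real.norm_of_nonneg ht.1] at h1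
    calc _ ≤ ‖gradient f (v + t • (u - v)) - gradient f v‖ * ‖u - v‖ := norm_inner_le_norm _ _
      _ ≤ (L * (t * ‖u - v‖)) * ‖u - v‖ := by gcongr
      _ = _ := by ring

/-- The Bregman distance `D_H(u, v) = H u - H v - ⟪∇ H v, u - v⟫` of the kernel
`H = a / 2 * ‖·‖ ^ 2 - b * f`. -/
noncomputable def bregmanGap (a b : ℝ) (f : E → ℝ) (u v : E) : ℝ :=
  a / 2 * ‖u - v‖ ^ 2 - b * (f u - f v - inner ℝ (gradient f v) (u - v))

lemma bregmanGap_self (a b : ℝ) (f : E → ℝ) (u : E) : bregmanGap a b f u u = 0 := by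
  simp [bregmanGap]

lemma bregmanGap_three_point (a b : ℝ) (f : E → ℝ) (w z y : E) :
    bregmanGap a b f w y = bregmanGap a b f z y + bregmanGap a b f w z +
      inner ℝ (a • (z - y) - b • (gradient f z - gradient f y)) (w - z) := by
  have h : w - y = (w - z) + (z - y) := by abel
  unfold bregmanGap
  rw [h, norm_add_sq_real, inner_add_right, inner_sub_left (a • _), inner_smul_left,
    inner_smul_left, inner_sub_left (gradient f z), real_inner_comm (w - z) (z - y)]
  simp only [conj_trivial]
  ring

lemma le_bregmanGap {f : E → ℝ} {L : ℝ≥0} (hf : Differentiable ℝ f)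
    (hL : LipschitzWith L (gradient f)) (a : ℝ) {b : ℝ} (hb : 0 ≤ b) (u v : E) :
    (a - b * L) / 2 * ‖u - v‖ ^ 2 ≤ bregmanGap a b f u v := by
  have := (abs_le.1 (abs_sub_linearization_le hf hL u v)).2
  unfold bregmanGap
  nlinarith [mul_le_mul_of_nonneg_left this hb]

lemma bregmanGap_le {f : E → ℝ} {L : ℝ≥0} (hf : Differentiable ℝ f)
    (hL : LipschitzWith L (gradient f)) (a : ℝ) {b : ℝ} (hb : 0 ≤ b) (u v : E) :
    bregmanGap a b f u v ≤ (a + b * L) / 2 * ‖u - v‖ ^ 2 := by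
  have := (abs_le.1 (abs_sub_linearization_le hf hL u v)).1
  unfold bregmanGap
  nlinarith [mul_le_mul_of_nonneg_left this hb]

lemma continuous_bregmanGap {f : E → ℝ} {L : ℝ≥0} (hf : Differentiable ℝ f)
    (hL : LipschitzWith L (gradient f)) (a b : ℝ) (u : E) : Continuous (bregmanGap a b f u) := by
  have h1 := hf.continuous
  have h2 := hL.continuous
  unfold bregmanGap
  fun_prop

end Bregman

/-! ### The block-structured problem -/

section Blocks

variable {N : ℕ} {n : Fin N → ℕ}

lemma norm_le_of_forall_block_le {v w : BCPG.BlockSpace n} {K : ℝ} (hK : 0 ≤ K)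
    (h : ∀ i, ‖v i‖ ≤ K * ‖w i‖) : ‖v‖ ≤ K * ‖w‖ := by
  refine pow_le_pow_iff_left₀ (norm_nonneg _) (by positivity) two_ne_zero |>.1 ?_
  rw [mul_pow, PiLp.norm_sq_eq_of_L2, PiLp.norm_sq_eq_of_L2, Finset.mul_sum]
  refine Finset.sum_le_sum fun i _ => ?_
  rw [← mul_pow]
  exact pow_le_pow_left₀ (norm_nonneg _) (h i) 2

lemma norm_le_card_mul_of_forall_block_le {v : BCPG.BlockSpace n} {M : ℝ} (hM : 0 ≤ M)
    (h : ∀ i, ‖v i‖ ≤ M) : ‖v‖ ≤ N * M := by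
  refine pow_le_pow_iff_left₀ (norm_nonneg _) (by positivity) two_ne_zero |>.1 ?_
  rw [PiLp.norm_sq_eq_of_L2]
  calc ∑ i, ‖v i‖ ^ 2 ≤ ∑ _i : Fin N, M ^ 2 :=
        Finset.sum_le_sum fun i _ => pow_le_pow_left₀ (norm_nonneg _) (h i) 2
    _ = N * M ^ 2 := by simp
    _ ≤ N ^ 2 * M ^ 2 := by
        gcongr
        exact_mod_cast Nat.le_self_pow two_ne_zero N
    _ = (N * M) ^ 2 := by ring

lemma blockDiag_isSymmetric (c : Fin N → ℝ) : (BCPG.blockDiag n c).IsSymmetric := by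
  intro v w
  rw [PiLp.inner_apply, PiLp.inner_apply]
  refine Finset.sum_congr rfl fun i _ => ?_
  simp only [BCPG.blockDiag, LinearMap.coe_mk, AddHom.coe_mk, inner_smul_left, inner_smul_right,
    conj_trivial]

lemma gradient_smoothTerm_apply {f : ∀ i, EuclideanSpace ℝ (Fin (n i)) → ℝ}
    (hf : ∀ i, Differentiable ℝ (f i)) (y : BCPG.BlockSpace n) (i : Fin N) :
    gradient (BCPG.smoothTerm f) y i = (1 / (N : ℝ)) • gradient (f i) (y i) := by
  have h : HasGradientAt (BCPG.smoothTerm f)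
      (WithLp.toLp 2 fun i => (1 / (N : ℝ)) • gradient (f i) (y i)) y := by
    rw [hasGradientAt_iff_hasFDerivAt]
    have h1 : HasFDerivAt (BCPG.smoothTerm f) ((1 / (N : ℝ)) • ∑ i,
        (InnerProductSpace.toDual ℝ _ (gradient (f i) (y i))).comp
          (PiLp.proj 2 (𝕜 := ℝ) (fun i => EuclideanSpace ℝ (Fin (n i))) i)) y :=
      (HasFDerivAt.fun_sum fun i _ => (hf i (y i)).hasGradientAt.hasFDerivAt.comp y
        (PiLp.proj 2 (𝕜 := ℝ) (fun i => EuclideanSpace ℝ (Fin (n i))) i).hasFDerivAt).const_mul _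
    convert! h1 using 1
    ext v
    simp [PiLp.inner_apply, inner_smul_left, Finset.mul_sum]
  rw [h.gradient]

/-- The Bregman distance of `½ ‖·‖² - F` in the metric of the inverse stepsizes, which is the sum
of the Bregman distances of the blocks. -/
noncomputable def blockGap (f : ∀ i, EuclideanSpace ℝ (Fin (n i)) → ℝ) (γ : Fin N → ℝ)
    (w y : BCPG.BlockSpace n) : ℝ :=
  ∑ i, bregmanGap (γ i)⁻¹ (1 / (N : ℝ)) (f i) (w i) (y i)

/-- The difference at `z` and `y` of the gradients of the kernel of `blockGap`. -/
noncomputable def blockGapGradient (f : ∀ i, EuclideanSpace ℝ (Fin (n i)) → ℝ) (γ : Fin N → ℝ)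
    (z y : BCPG.BlockSpace n) : BCPG.BlockSpace n :=
  WithLp.toLp 2 fun i => (γ i)⁻¹ • (z i - y i) -
    (1 / (N : ℝ)) • (gradient (f i) (z i) - gradient (f i) (y i))

lemma blockGap_three_point (f : ∀ i, EuclideanSpace ℝ (Fin (n i)) → ℝ) (γ : Fin N → ℝ)
    (w z y : BCPG.BlockSpace n) : blockGap f γ w y =
      blockGap f γ z y + blockGap f γ w z + inner ℝ (blockGapGradient f γ z y) (w - z) := by
  rw [PiLp.inner_apply]
  unfold blockGap
  rw [← Finset.sum_add_distrib, ← Finset.sum_add_distrib]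
  exact Finset.sum_congr rfl fun i _ => bregmanGap_three_point _ _ _ _ _ _

/-- Up to a constant, the objective of the proximal step is the cost plus the Bregman distance to
the current point, by completing the square. -/
lemma exists_smoothTerm_add_blockGap_eq {f : ∀ i, EuclideanSpace ℝ (Fin (n i)) → ℝ}
    (hf : ∀ i, Differentiable ℝ (f i)) {γ : Fin N → ℝ} (hγ : ∀ i, 0 < γ i)
    (y : BCPG.BlockSpace n) : ∃ κ : ℝ, ∀ w, BCPG.smoothTerm f w + blockGap f γ w y =
      1 / 2 * inner ℝ (w - (y - BCPG.blockDiag n γ (gradient (BCPG.smoothTerm f) y)))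
        (BCPG.blockDiag n (fun i => (γ i)⁻¹)
          (w - (y - BCPG.blockDiag n γ (gradient (BCPG.smoothTerm f) y)))) + κ := by
  refine ⟨∑ i, (1 / (N : ℝ) * f i (y i) -
    γ i / 2 * ‖(1 / (N : ℝ)) • gradient (f i) (y i)‖ ^ 2), fun w => ?_⟩
  rw [PiLp.inner_apply, Finset.mul_sum, ← Finset.sum_add_distrib]
  rw [show BCPG.smoothTerm f w = 1 / (N : ℝ) * ∑ i, f i (w i) from rfl, blockGap,
    Finset.mul_sum, ← Finset.sum_add_distrib]
  refine Finset.sum_congr rfl fun i _ => ?_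
  have hu : (w - (y - BCPG.blockDiag n γ (gradient (BCPG.smoothTerm f) y))) i =
      (w i - y i) + γ i • ((1 / (N : ℝ)) • gradient (f i) (y i)) := by
    rw [← gradient_smoothTerm_apply hf]
    change w i - (y i - γ i • gradient (BCPG.smoothTerm f) y i) = _
    abel
  change _ = 1 / 2 * inner ℝ _ ((γ i)⁻¹ •
    (w - (y - BCPG.blockDiag n γ (gradient (BCPG.smoothTerm f) y))) i) + _
  have hin : inner ℝ (gradient (f i) (y i)) (w i - y i) * (1 / (N : ℝ)) =
      inner ℝ (w i - y i) ((1 / (N : ℝ)) • gradient (f i) (y i)) := by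
    rw [inner_smul_right, real_inner_comm, mul_comm]
  rw [hu, inner_smul_right, real_inner_self_eq_norm_sq, norm_add_sq_real, norm_smul (γ i),
    inner_smul_right, ← hin, mul_pow, Real.norm_eq_abs, sq_abs]
  unfold bregmanGap
  have := (hγ i).ne'
  field_simp
  ring

/-- The proximal step minimizes the cost plus the Bregman distance to the current point. -/
lemma cost_add_blockGap_le {f : ∀ i, EuclideanSpace ℝ (Fin (n i)) → ℝ}
    (hf : ∀ i, Differentiable ℝ (f i)) {G : BCPG.BlockSpace n → EReal} {γ : Fin N → ℝ}
    (hγ : ∀ i, 0 < γ i) {y z : BCPG.BlockSpace n}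
    (hz : z ∈ BCPG.prox (BCPG.blockDiag n fun i => (γ i)⁻¹) G
      (y - BCPG.blockDiag n γ (gradient (BCPG.smoothTerm f) y))) (w : BCPG.BlockSpace n) :
    BCPG.cost f G z + (blockGap f γ z y : EReal) ≤
      BCPG.cost f G w + (blockGap f γ w y : EReal) := by
  obtain ⟨κ, hκ⟩ := exists_smoothTerm_add_blockGap_eq hf hγ y
  have h : ∀ w, BCPG.cost f G w + (blockGap f γ w y : EReal) =
      G w + ((1 / 2 * inner ℝ (w - (y - BCPG.blockDiag n γ (gradient (BCPG.smoothTerm f) y)))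
        (BCPG.blockDiag n (fun i => (γ i)⁻¹)
          (w - (y - BCPG.blockDiag n γ (gradient (BCPG.smoothTerm f) y)))) : ℝ) : EReal) + κ := by
    intro w
    rw [BCPG.cost, add_assoc (G w), ← EReal.coe_add, ← hκ, EReal.coe_add,
      add_comm (BCPG.smoothTerm f w : EReal) (G w), add_assoc]
  rw [h, h]
  exact add_le_add_left (hz w) _

lemma cost_isProper {f : ∀ i, EuclideanSpace ℝ (Fin (n i)) → ℝ} {G : BCPG.BlockSpace n → EReal}
    (hG : BCPG.IsProper G) : BCPG.IsProper (BCPG.cost f G) := by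
  obtain ⟨h1, w, hw⟩ := hG
  refine ⟨fun y => ?_, w, (EReal.add_lt_top (EReal.coe_ne_top _) hw).ne⟩
  rw [BCPG.cost, Ne, EReal.add_eq_bot_iff]
  exact fun h => h.elim (EReal.coe_ne_bot _) (h1 y)

lemma cost_lowerSemicontinuous {f : ∀ i, EuclideanSpace ℝ (Fin (n i)) → ℝ}
    (hf : ∀ i, Differentiable ℝ (f i)) {G : BCPG.BlockSpace n → EReal}
    (hG : LowerSemicontinuous G) : LowerSemicontinuous (BCPG.cost f G) := by
  have hcont : Continuous (BCPG.smoothTerm f) := by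
    have := fun i => (hf i).continuous
    unfold BCPG.smoothTerm
    fun_prop
  exact ((continuous_coe_real_ereal.comp hcont).lowerSemicontinuous).add' hG fun y =>
    EReal.continuousAt_add (Or.inl (EReal.coe_ne_top _)) (Or.inl (EReal.coe_ne_bot _))

/-- Since `γ i * L i < N`, the forward step is Lipschitz with constant `2`, so the
forward-backward step is a Lipschitz function of the current point. -/
lemma norm_sub_le_of_forward_backward {f : ∀ i, EuclideanSpace ℝ (Fin (n i)) → ℝ}
    {L : Fin N → ℝ≥0} {G : BCPG.BlockSpace n → EReal} (hs : BCPG.ProblemSetting f L G)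
    (hconv : BCPG.IsConvex G) {γ : Fin N → ℝ} (hγ : ∀ i, 0 < γ i ∧ γ i * L i < N) {c M : ℝ}
    (hc : 0 < c) (hcγ : ∀ i, c ≤ (γ i)⁻¹) (hM : 0 ≤ M) (hMγ : ∀ i, (γ i)⁻¹ ≤ M)
    {I : ℕ → Set (Fin N)} {x z : ℕ → BCPG.BlockSpace n} (hxz : BCPG.IsBCSequence f G γ I x z)
    (k l : ℕ) : ‖z k - z l‖ ≤ M / c * (2 * ‖x k - x l‖) := by
  refine (norm_sub_le_of_mem_prox (K := M) (blockDiag_isSymmetric _) hc (fun v => ?_) (fun v => ?_)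
    hs.proper hconv (hxz.forward_backward k) (hxz.forward_backward l)).trans ?_
  · rw [PiLp.norm_sq_eq_of_L2, PiLp.inner_apply, Finset.mul_sum]
    refine Finset.sum_le_sum fun i _ => ?_
    change _ ≤ inner ℝ ((γ i)⁻¹ • v i) (v i)
    rw [inner_smul_left, conj_trivial, real_inner_self_eq_norm_sq]
    gcongr
    exact hcγ i
  · refine norm_le_of_forall_block_le hM fun i => ?_
    change ‖(γ i)⁻¹ • v i‖ ≤ _
    rw [norm_smul, Real.norm_of_nonneg (inv_nonneg.2 (hγ i).1.le)]
    gcongr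
    exact hMγ i
  · gcongr
    refine norm_le_of_forall_block_le zero_le_two fun i => ?_
    change ‖(x k i - γ i • gradient (BCPG.smoothTerm f) (x k) i) -
      (x l i - γ i • gradient (BCPG.smoothTerm f) (x l) i)‖ ≤ 2 * ‖x k i - x l i‖
    rw [gradient_smoothTerm_apply hs.differentiable, gradient_smoothTerm_apply hs.differentiable]
    have hN : (0 : ℝ) < N :=
      (mul_nonneg (hγ i).1.le (L i).coe_nonneg).trans_lt (hγ i).2
    have h1 := (hs.lipschitz_gradient i).dist_le_mul (x k i) (x l i)
    rw [dist_eq_norm, dist_eq_norm] at h1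
    have h2 : γ i * (1 / (N : ℝ)) * L i ≤ 1 := by
      rw [mul_one_div, div_mul_eq_mul_div, div_le_one hN]
      exact (hγ i).2.le
    have e : (x k i - γ i • ((1 / (N : ℝ)) • gradient (f i) (x k i))) -
        (x l i - γ i • ((1 / (N : ℝ)) • gradient (f i) (x l i))) =
        (x k i - x l i) - (γ i * (1 / (N : ℝ))) • (gradient (f i) (x k i) -
          gradient (f i) (x l i)) := by module
    rw [e]
    refine (norm_sub_le _ _).trans ?_
    have hγN : 0 ≤ γ i * (1 / (N : ℝ)) := mul_nonneg (hγ i).1.le (by positivity)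
    rw [norm_smul, Real.norm_of_nonneg hγN]
    calc _ ≤ ‖x k i - x l i‖ + γ i * (1 / (N : ℝ)) * (L i * ‖x k i - x l i‖) := by gcongr
      _ = ‖x k i - x l i‖ + (γ i * (1 / (N : ℝ)) * L i) * ‖x k i - x l i‖ := by ring
      _ ≤ ‖x k i - x l i‖ + 1 * ‖x k i - x l i‖ := by gcongr
      _ = _ := by ring

/-- If `z` depends on `x` in a Lipschitz way and every block is updated within `T` steps, then each
block of the residual `z k - x k` is compared with the step that next updates this block. -/
lemma residual_le_window {f : ∀ i, EuclideanSpace ℝ (Fin (n i)) → ℝ}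
    {G : BCPG.BlockSpace n → EReal} {γ : Fin N → ℝ} {I : ℕ → Set (Fin N)}
    {x z : ℕ → BCPG.BlockSpace n} (hxz : BCPG.IsBCSequence f G γ I x z) {T : ℕ}
    (hT : ∀ (k : ℕ) (i : Fin N), ∃ t, 1 ≤ t ∧ t ≤ T ∧ i ∈ I (k + t)) {K : ℝ} (hK : 0 ≤ K)
    (hz : ∀ k l, ‖z k - z l‖ ≤ K * ‖x k - x l‖) (k : ℕ) :
    ‖z k - x k‖ ≤ N * (K + 2) * ∑ t ∈ Finset.range T, ‖x (k + t + 1) - x (k + t)‖ := by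
  set W := ∑ t ∈ Finset.range T, ‖x (k + t + 1) - x (k + t)‖ with hW
  have hW0 : 0 ≤ W := Finset.sum_nonneg fun _ _ => norm_nonneg _
  rw [mul_assoc]
  refine norm_le_card_mul_of_forall_block_le (by positivity) fun i => ?_
  obtain ⟨t, ht1, htT, hti⟩ := hT k i
  obtain ⟨s, rfl⟩ : ∃ s, t = s + 1 := ⟨t - 1, by omega⟩
  have hxW : ‖x k - x (k + s)‖ ≤ W := by
    have h1 := dist_le_range_sum_dist (fun t => x (k + t)) s
    rw [← dist_eq_norm]
    refine h1.trans (le_trans (le_of_eq (Finset.sum_congr rfl fun t _ => ?_))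
      (Finset.sum_le_sum_of_subset_of_nonneg (Finset.range_subset_range.2 (by omega : s ≤ T))
        fun _ _ _ => norm_nonneg _))
    rw [dist_comm, dist_eq_norm, add_assoc]
  have hd : ‖x (k + s + 1) - x (k + s)‖ ≤ W :=
    Finset.single_le_sum (f := fun t => ‖x (k + t + 1) - x (k + t)‖)
      (fun _ _ => norm_nonneg _) (Finset.mem_range.2 (by omega))
  have hup : x (k + s + 1) i = z (k + s) i := hxz.update (k + s) i hti
  have e : (z k - x k) i = (z k - z (k + s)) i + (x (k + s + 1) - x (k + s)) i
      - (x k - x (k + s)) i := by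
    simp only [PiLp.sub_apply, hup]
    abel
  rw [e]
  calc _ ≤ ‖(z k - z (k + s)) i‖ + ‖(x (k + s + 1) - x (k + s)) i‖ + ‖(x k - x (k + s)) i‖ :=
        (norm_sub_le _ _).trans (add_le_add_left (norm_add_le _ _) _)
    _ ≤ ‖z k - z (k + s)‖ + ‖x (k + s + 1) - x (k + s)‖ + ‖x k - x (k + s)‖ := by
        gcongr <;> exact PiLp.norm_apply_le _ _
    _ ≤ K * W + W + W := by
        gcongr
        exact (hz _ _).trans (by gcongr)
    _ = (K + 2) * W := by ring

/-- Updating some blocks of `x k` to those of `z k` lowers the Bregman distance from `z k`, by the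
contributions of these blocks. -/
lemma blockGap_update_le {f : ∀ i, EuclideanSpace ℝ (Fin (n i)) → ℝ}
    {G : BCPG.BlockSpace n → EReal} {γ : Fin N → ℝ} {I : ℕ → Set (Fin N)}
    {x z : ℕ → BCPG.BlockSpace n} (hxz : BCPG.IsBCSequence f G γ I x z) {c : ℝ}
    (hc : ∀ i u v, c * ‖u - v‖ ^ 2 ≤ bregmanGap (γ i)⁻¹ (1 / (N : ℝ)) (f i) u v) (k : ℕ) :
    blockGap f γ (z k) (x (k + 1)) + c * ‖x (k + 1) - x k‖ ^ 2 ≤ blockGap f γ (z k) (x k) := by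
  rw [PiLp.norm_sq_eq_of_L2, Finset.mul_sum]
  unfold blockGap
  rw [← Finset.sum_add_distrib]
  refine Finset.sum_le_sum fun i _ => ?_
  rw [PiLp.sub_apply]
  by_cases hi : i ∈ I (k + 1)
  · rw [hxz.update k i hi, bregmanGap_self, zero_add]
    exact hc i _ _
  · simp [hxz.keep k i hi]

/-- The block-coordinate iteration is a model descent for the Bregman distance `blockGap`. -/
theorem exists_isModelDescent {f : ∀ i, EuclideanSpace ℝ (Fin (n i)) → ℝ}
    {L : Fin N → ℝ≥0} {G : BCPG.BlockSpace n → EReal} (hs : BCPG.ProblemSetting f L G)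
    (hconv : BCPG.IsConvex G) {γ : Fin N → ℝ} (hγ : ∀ i, 0 < γ i ∧ γ i * L i < N)
    {I : ℕ → Set (Fin N)} (hI : BCPG.EssentiallyCyclic I) {x z : ℕ → BCPG.BlockSpace n}
    (hxz : BCPG.IsBCSequence f G γ I x z) : ∃ (c C : ℝ) (T : ℕ),
      IsModelDescent (BCPG.cost f G) (blockGap f γ) (blockGapGradient f γ) c C T x z := by
  obtain ⟨T, hT1, hT⟩ := hI
  have hN : (0 : ℝ) ≤ 1 / (N : ℝ) := by positivity
  have hd := hs.differentiable
  have hL := hs.lipschitz_gradient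
  have hNL : ∀ i, 0 ≤ 1 / (N : ℝ) * L i := fun i => mul_nonneg hN (L i).coe_nonneg
  have hμ : ∀ i, 0 < ((γ i)⁻¹ - 1 / (N : ℝ) * L i) / 2 := fun i => by
    have hN' : (0 : ℝ) < N := (mul_nonneg (hγ i).1.le (L i).coe_nonneg).trans_lt (hγ i).2
    refine half_pos (sub_pos.2 ?_)
    rw [one_div_mul_eq_div, inv_eq_one_div, div_lt_div_iff₀ hN' (hγ i).1, one_mul, mul_comm]
    exact (hγ i).2
  obtain ⟨c, hcμ, hc⟩ : ∃ c, (∀ i, c ≤ ((γ i)⁻¹ - 1 / (N : ℝ) * L i) / 2) ∧ 0 < c :=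
    ((eventually_all.2 fun i => (eventually_le_nhds (hμ i)).filter_mono
      nhdsWithin_le_nhds).and self_mem_nhdsWithin : ∀ᶠ c in 𝓝[>] (0 : ℝ), _ ∧ 0 < c).exists
  set M := ∑ i, ((γ i)⁻¹ + 1 / (N : ℝ) * L i) with hM
  have hMi0 : ∀ i, 0 ≤ (γ i)⁻¹ + 1 / (N : ℝ) * L i := fun i =>
    add_nonneg (inv_nonneg.2 (hγ i).1.le) (hNL i)
  have hMi : ∀ i, (γ i)⁻¹ + 1 / (N : ℝ) * L i ≤ M := fun i =>
    Finset.single_le_sum (f := fun i => (γ i)⁻¹ + 1 / (N : ℝ) * L i) (fun j _ => hMi0 j)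
      (Finset.mem_univ i)
  have hM0 : 0 ≤ M := Finset.sum_nonneg fun i _ => hMi0 i
  have hinv : ∀ i, 0 < (γ i)⁻¹ := fun i => inv_pos.2 (hγ i).1
  have hlip := norm_sub_le_of_forward_backward hs hconv hγ hc
    (fun i => by linarith [hcμ i, hNL i, hinv i]) hM0 (fun i => by linarith [hMi i, hNL i]) hxz
  set K := M / c * 2 with hK
  have hK0 : 0 ≤ K := by positivity
  have hlow : ∀ i u v, c * ‖u - v‖ ^ 2 ≤ bregmanGap (γ i)⁻¹ (1 / (N : ℝ)) (f i) u v :=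
    fun i u v => le_trans (by gcongr; exact hcμ i) (le_bregmanGap (hd i) (hL i) _ hN u v)
  set C := M + N * (K + 2) + 1 with hC
  have hNK : 0 ≤ N * (K + 2) := by positivity
  have hMC : M ≤ C := by linarith
  refine ⟨c, C, T, hc, by linarith, hT1, fun w y => ?_, fun w y => ?_, fun w => ?_,
    blockGap_three_point f γ, fun w y => ?_, fun k => ?_, blockGap_update_le hxz hlow,
    fun k => ?_⟩
  · exact Finset.sum_nonneg fun i _ => le_trans (by positivity) (hlow i _ _)
  · rw [PiLp.norm_sq_eq_of_L2, Finset.mul_sum]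
    refine Finset.sum_le_sum fun i _ => (bregmanGap_le (hd i) (hL i) _ hN _ _).trans ?_
    rw [PiLp.sub_apply]
    gcongr
    linarith [hMi i, hMi0 i]
  · refine continuous_finsetSum _ fun i _ => ?_
    exact (continuous_bregmanGap (hd i) (hL i) _ _ _).comp (by fun_prop)
  · refine norm_le_of_forall_block_le (by linarith) fun i => ?_
    have h1 := (hL i).dist_le_mul (w i) (y i)
    rw [dist_eq_norm, dist_eq_norm] at h1
    refine (norm_sub_le _ _).trans ?_
    rw [norm_smul, norm_smul, Real.norm_of_nonneg hN, Real.norm_of_nonneg (hinv i).le,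
      PiLp.sub_apply]
    calc _ ≤ (γ i)⁻¹ * ‖w i - y i‖ + 1 / (N : ℝ) * (L i * ‖w i - y i‖) := by gcongr
      _ = ((γ i)⁻¹ + 1 / (N : ℝ) * L i) * ‖w i - y i‖ := by ring
      _ ≤ C * ‖w i - y i‖ := by gcongr; exact (hMi i).trans hMC
  · exact cost_add_blockGap_le hd (fun i => (hγ i).1) (hxz.forward_backward k)
  · refine (residual_le_window hxz hT hK0 (fun k l => ?_) k).trans ?_
    · rw [hK, mul_assoc]; exact hlip k l
    · gcongr
      linarith

end Blocks

theorem mainTheorem1 {N : ℕ} (n : Fin N → ℕ)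
    (f : ∀ i, EuclideanSpace ℝ (Fin (n i)) → ℝ) (L : Fin N → ℝ≥0)
    (G : BCPG.BlockSpace n → EReal)
    (hsetting : BCPG.ProblemSetting f L G)
    (hconvex : BCPG.IsConvex G)
    (θ : ℝ) (hθ₀ : 0 < θ) (hθ₁ : θ < 1)
    (hKL : BCPG.HasKL (BCPG.cost f G) θ)
    (hcoercive : BCPG.IsCoercive (BCPG.cost f G))
    -- stepsizes in the open interval from `0` to `N / L i`, which is unbounded if `L i = 0`
    (γ : Fin N → ℝ) (hγ : ∀ i, 0 < γ i ∧ γ i * L i < N)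
    (I : ℕ → Set (Fin N)) (hI : BCPG.EssentiallyCyclic I)
    (x z : ℕ → BCPG.BlockSpace n)
    (hxz : BCPG.IsBCSequence f G γ I x z) :
    ∃ xstar : BCPG.BlockSpace n,
      BCPG.IsStationary (BCPG.cost f G) xstar ∧
      Tendsto x atTop (𝓝 xstar) ∧
      Tendsto z atTop (𝓝 xstar) ∧
      (θ ≤ 1 / 2 →
        BCPG.ConvergesRLinearly (fun k => ‖z k - x k‖) 0 ∧
        BCPG.ConvergesRLinearly x xstar ∧
        BCPG.ConvergesRLinearly z xstar) := by
  obtain ⟨c, C, T, h⟩ := exists_isModelDescent hsetting hconvex hγ hI hxz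
  exact h.convergence (cost_isProper hsetting.proper)
    (cost_lowerSemicontinuous hsetting.differentiable hsetting.lsc) hsetting.exists_min
    hcoercive hθ₁ hKL
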